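/- Let $q$ be a prime power and let $G=\mathrm{PSL}(2,q)=\mathrm{SL}(2,q)/Z(\mathrm{SL}(2,q))$ act on the projective line $\mathbb{P}_q$ over $\mathbb{F}_q$ (which has $q+1$ points). Call a subset $S\subseteq G$ *intersecting* if for all $\pi,\sigma\in S$ the element $\pi\sigma^{-1}$ fixes a point of $\mathbb{P}_q$, and call it a *maximum* intersecting set if it has the largest size among all intersecting subsets of $G$. For a character $\chi$ of $G$, let the $\chi$-module be the subspace of $\mathbb{C}^{G}$ spanned by the columns of the $G\times G$ matrix $E_\chi$ with entries $(E_\chi)_{\pi,\sigma}=\frac{\chi(1)}{|G|}\chi(\pi^{-1}\sigma)$. The *trivial module* is the $\chi$-module for $\chi=1$, and the *standard module* is the $\chi$-module for the standard character $\chi(g)=|\{x\in\mathbb{P}_q : gx=x\}|-1$. Then: 1. $G$ has the EKR property: every intersecting subset of $G$ has size at most that of the largest point stabilizer of $G$ in $\mathbb{P}_q$. 2. The sum of the trivial module and the standard module is direct, and for every maximum intersecting set $S\subseteq G$ the characteristic vector $v_S\in\mathbb{C}^{G}$ of $S$ lies in this direct sum. -/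

import Mathlib

open scoped LinearAlgebra.Projectivization MatrixGroups

namespace EKR

section Intersecting

variable (G : Type*) [Group G] (Ω : Type*) [MulAction G Ω]

/-- A set of elements of `G` is intersecting for the action on `Ω` if, for any two of its
elements `π` and `σ`, the element `π * σ⁻¹` fixes a point. -/
def IsIntersecting (S : Finset G) : Prop :=
  ∀ π ∈ S, ∀ σ ∈ S, ∃ x : Ω, (π * σ⁻¹) • x = x

/-- An intersecting set of the largest possible size. -/
def IsMaximumIntersecting (S : Finset G) : Prop :=
  IsIntersecting G Ω S ∧ ∀ T : Finset G, IsIntersecting G Ω T → T.card ≤ S.card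

/-- The EKR property of a finite group acting on `Ω`: the size of an intersecting set is at most
the size of the largest point stabilizer. -/
def HasEKRProperty [Finite G] : Prop :=
  ∀ S : Finset G, IsIntersecting G Ω S → ∃ x : Ω, S.card ≤ Nat.card (MulAction.stabilizer G x)

end Intersecting

noncomputable section Modules

variable (G : Type*) [Group G]

/-- The matrix `E_χ` with entries `(χ(1) / |G|) χ(π⁻¹ σ)`. -/
def idempotentMatrix [Finite G] (χ : G → ℂ) : Matrix G G ℂ :=
  Matrix.of fun π σ => χ 1 / (Nat.card G : ℂ) * χ (π⁻¹ * σ)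

/-- The `χ`-module: the space generated by the columns of `E_χ`. -/
def characterModule [Finite G] (χ : G → ℂ) : Submodule ℂ (G → ℂ) :=
  Submodule.span ℂ (Set.range (idempotentMatrix G χ).col)

/-- The character of the trivial representation. -/
def trivialCharacter : G → ℂ :=
  (Representation.trivial ℂ G ℂ).character

/-- The standard character: the character of the permutation representation on `Ω`, minus one. -/
def standardCharacter (Ω : Type*) [MulAction G Ω] : G → ℂ :=
  fun g => (Representation.ofMulAction ℂ G Ω).character g - 1

/-- The trivial module, a space of functions on `G`. -/
def trivialModule [Finite G] : Submodule ℂ (G → ℂ) :=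
  characterModule G (trivialCharacter G)

/-- The standard module, a space of functions on `G`. -/
def standardModule [Finite G] (Ω : Type*) [MulAction G Ω] : Submodule ℂ (G → ℂ) :=
  characterModule G (standardCharacter G Ω)

/-- The characteristic vector of `S`. -/
def characteristicVector (S : Finset G) : G → ℂ :=
  Set.indicator (S : Set G) 1

end Modules

end EKR

set_option linter.unusedSectionVars false

/-! ### Root families and counts over pairs of points. -/

namespace EKR

open Finset

/-! The proof is a ratio (Hoffman) bound for the derangement graph, without a character table. Let
`s` be the order of a two-point stabilizer and `d = derangementDegree q s`. With `A` the adjacency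
matrix of the graph and `J` the all-ones matrix, `weightMatrix` is `M = d I + A - (d / (q s)) J`. If
`M` is positive semidefinite, evaluating it at the indicator of an intersecting set `S` gives `#S ≤
q s`, the order of a point stabilizer. Equality puts the indicator in the kernel of `M`.

The key is `fixCount_add_rootCount`: off the identity, `A` is given by `1 - (fixCount + rootCount) /
2`. The image of `M` is balanced (`mulVec_mem_balanced`). On balanced functions the constant and
`fixCount` terms vanish, leaving the identity and the sum of the root subgroups. Two root subgroups
generate the group, so in a representation without invariants their fixed spaces are independent.
Taking traces bounds the scalar by which that sum can act (`IsRootFamily.scalar_le`). With `q ≤ 2 s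
+ 1`, all eigenvalues of `M` on balanced functions are then positive (`eq_zero_of_mulVec_eq_smul`).
So `M` is positive semidefinite, and `eq_of_mulVec_eq_zero` puts its kernel in the sum of the two
modules.

For `PSL(2, F)` the root subgroups are the conjugates of the unitriangular group, and diagonal
matrices give `q ≤ 2 s + 1`. -/

/-- A family of subgroups `U x` of a group acting on `Ω`, generating the group, with `U x` fixing
`x` and acting regularly on the other points, such that the elements fixing exactly one point `x`
lie in `U x` and only the identity fixes three points. -/
structure IsRootFamily {G Ω : Type*} [Group G] [MulAction G Ω] (U : Ω → Subgroup G) : Prop where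
  conj_mem : ∀ (g : G) (x : Ω) (u : G), u ∈ U x → g * u * g⁻¹ ∈ U (g • x)
  smul_eq : ∀ (x : Ω) (u : G), u ∈ U x → u • x = x
  existsUnique : ∀ x y z : Ω, y ≠ x → z ≠ x → ∃! u, u ∈ U x ∧ u • y = z
  eq_one : ∀ (g : G) (x y z : Ω), x ≠ y → x ≠ z → y ≠ z → g • x = x → g • y = y → g • z = z → g = 1
  mem_of_fixes_only : ∀ (g : G) (x : Ω), g • x = x → (∀ y, g • y = y → y = x) → g ∈ U x
  iSup_eq_top : ⨆ x, U x = ⊤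

theorem sum_eq_add_card_mul {Ω : Type*} [Fintype Ω] [DecidableEq Ω] {q : ℕ}
    (hΩ : Fintype.card Ω = q + 1) {f : Ω → ℝ} {a r : ℝ} (y : Ω) (hy : f y = a)
    (h : ∀ x, x ≠ y → f x = r) : ∑ x, f x = a + q * r := by
  rw [← add_sum_erase _ _ (mem_univ y), hy,
    sum_congr (rfl : univ.erase y = _) (fun x hx => h x (ne_of_mem_erase hx))]
  simp [hΩ]

section Counting

variable {G Ω : Type*} [Group G] [Fintype G] [MulAction G Ω] [Fintype Ω] [DecidableEq Ω]

theorem card_pair_left (h : G) (a c b d : Ω) :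
    #{g : G | g • a = b ∧ g • c = d} = #{g : G | g • a = h • b ∧ g • c = h • d} := by
  refine card_bij' (fun g _ => h * g) (fun g _ => h⁻¹ * g) ?_ ?_ ?_ ?_ <;>
    simp +contextual [mul_smul]

theorem card_pair_right (h : G) (a c b d : Ω) :
    #{g : G | g • a = b ∧ g • c = d} = #{g : G | g • (h • a) = b ∧ g • (h • c) = d} := by
  refine card_bij' (fun g _ => g * h⁻¹) (fun g _ => g * h) ?_ ?_ ?_ ?_ <;>
    simp +contextual [mul_smul]

/-- By 2-transitivity, left and right translations carry any such set of elements onto any other. -/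
theorem card_pair_eq [h2 : MulAction.IsMultiplyPretransitive G Ω 2] {a c b d a' c' b' d' : Ω}
    (h : a ≠ c) (h' : b ≠ d) (k : a' ≠ c') (k' : b' ≠ d') :
    #{g : G | g • a = b ∧ g • c = d} = #{g : G | g • a' = b' ∧ g • c' = d'} := by
  rw [MulAction.is_two_pretransitive_iff] at h2
  obtain ⟨g, rfl, rfl⟩ := h2 h k
  obtain ⟨g', rfl, rfl⟩ := h2 h' k'
  rw [← card_pair_left, ← card_pair_right]

/-- The number of fixed points of `g`. -/
def fixCount (Ω : Type*) [MulAction G Ω] [Fintype Ω] [DecidableEq Ω] (g : G) : ℝ :=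
  ∑ x : Ω, if g • x = x then 1 else 0

theorem fixCount_inv (g : G) : fixCount Ω g⁻¹ = fixCount Ω g := by
  simp only [fixCount, inv_smul_eq_iff]
  simp only [eq_comm]

theorem fixCount_conj (h g : G) : fixCount Ω (h * g * h⁻¹) = fixCount Ω g := by
  unfold fixCount
  refine Fintype.sum_equiv (MulAction.toPerm h⁻¹) _ _ fun x => ?_
  simp [mul_smul, eq_inv_smul_iff]

open Classical in
/-- The number of subgroups `U x` that contain `g`. -/
noncomputable def rootCount (U : Ω → Subgroup G) (g : G) : ℝ :=
  ∑ x : Ω, if g ∈ U x then 1 else 0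

theorem rootCount_inv (U : Ω → Subgroup G) (g : G) : rootCount U g⁻¹ = rootCount U g := by
  classical
  exact sum_congr rfl fun x _ => if_congr _root_.inv_mem_iff rfl rfl

namespace IsRootFamily

variable {U : Ω → Subgroup G} (hU : IsRootFamily U)

include hU

theorem conj_mem_iff (h g : G) (x : Ω) : h * g * h⁻¹ ∈ U x ↔ g ∈ U (h⁻¹ • x) := by
  constructor
  · intro hg
    simpa [mul_assoc] using hU.conj_mem h⁻¹ x _ hg
  · intro hg
    simpa using hU.conj_mem h _ _ hg

theorem rootCount_conj (h g : G) : rootCount U (h * g * h⁻¹) = rootCount U g := by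
  classical
  unfold rootCount
  exact Fintype.sum_equiv (MulAction.toPerm h⁻¹) _ _ fun x =>
    if_congr (hU.conj_mem_iff h g x) rfl rfl

theorem eq_one_of_mem {x y : Ω} {u : G} (hu : u ∈ U x) (hyx : y ≠ x) (hy : u • y = y) : u = 1 :=
  (hU.existsUnique x y y hyx hyx).unique ⟨hu, hy⟩ ⟨one_mem _, one_smul _ _⟩

/-- Since `U x` moves `y` to every `z ≠ x`, conjugating `U y` by `U x` produces every other `U z`.
-/
theorem sup_eq_top {x y : Ω} (hxy : x ≠ y) : U x ⊔ U y = ⊤ := by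
  rw [eq_top_iff, ← hU.iSup_eq_top]
  refine iSup_le fun z => ?_
  by_cases hzx : z = x
  · subst hzx; exact le_sup_left
  obtain ⟨u, ⟨hu, rfl⟩, -⟩ := hU.existsUnique x y z hxy.symm hzx
  intro v hv
  have h1 : u⁻¹ * v * u ∈ U y := by simpa using hU.conj_mem u⁻¹ _ _ hv
  have hu' : u ∈ U x ⊔ U y := Subgroup.mem_sup_left hu
  have := mul_mem (mul_mem hu' (Subgroup.mem_sup_right (S := U x) h1)) (inv_mem hu')
  simpa [mul_assoc] using this

open Classical in
theorem card_mem_and_smul_eq {x y z : Ω} (hy : y ≠ x) (hz : z ≠ x) :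
    (∑ g : G, if g ∈ U x ∧ g • y = z then (1 : ℝ) else 0) = 1 := by
  obtain ⟨u, hu, huniq⟩ := hU.existsUnique x y z hy hz
  rw [sum_eq_single u]
  · simp [hu]
  · intro g _ hg
    rw [if_neg fun h => hg (huniq g h)]
  · simp

open Classical in
theorem sum_mem {q : ℕ} (hq : 2 ≤ q) (hΩ : Fintype.card Ω = q + 1) (x : Ω) :
    (∑ g : G, if g ∈ U x then (1 : ℝ) else 0) = q := by
  have : Nontrivial Ω := Fintype.one_lt_card_iff_nontrivial.1 (by omega)
  obtain ⟨y, hy⟩ := exists_ne x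
  have h (g : G) : (if g ∈ U x then (1 : ℝ) else 0) =
      ∑ z : Ω, if g ∈ U x ∧ g • y = z then 1 else 0 := by
    by_cases hg : g ∈ U x <;> simp [hg]
  simp_rw [h]
  rw [sum_comm, sum_eq_add_card_mul (r := 1) (a := 0) hΩ x]
  · ring
  · refine sum_eq_zero fun g _ => if_neg ?_
    rintro ⟨hg, hgy⟩
    exact hy (smul_left_cancel g (hgy.trans (hU.smul_eq x g hg).symm))
  · intro z hz
    exact hU.card_mem_and_smul_eq hy hz

/-- Either `g` fixes one point and lies in one root subgroup, or it fixes two points and lies in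
none. On derangements both counts are zero, so half the sum detects fixed points away from the
identity. -/
theorem fixCount_add_rootCount {g : G} (hg : g ≠ 1) {x : Ω} (hx : g • x = x) :
    fixCount Ω g + rootCount U g = 2 := by
  classical
  by_cases h : ∀ y, g • y = y → y = x
  · have h1 : fixCount Ω g = 1 := by
      rw [fixCount, sum_eq_single x] <;> simp +contextual [hx]
      intro y hy hgy
      exact hy (h y hgy)
    have h2 : rootCount U g = 1 := by
      rw [rootCount, sum_eq_single x] <;> simp +contextual [hU.mem_of_fixes_only g x hx h]
      intro y hy hgy
      exact hy (h y (hU.smul_eq y g hgy))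
    rw [h1, h2]; norm_num
  · push Not at h
    obtain ⟨y, hy, hyx⟩ := h
    have h1 : fixCount Ω g = 2 := by
      rw [fixCount, ← sum_subset (subset_univ {x, y}), sum_pair hyx.symm]
      · simp [hx, hy]; norm_num
      · intro z _ hz
        simp only [mem_insert, mem_singleton, not_or] at hz
        rw [if_neg]
        intro hgz
        exact hg (hU.eq_one g x y z hyx.symm (Ne.symm hz.1) (Ne.symm hz.2) hx hy hgz)
    have h2 : rootCount U g = 0 := by
      refine sum_eq_zero fun z _ => ?_
      rw [if_neg]
      intro hgz
      by_cases hzx : z = x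
      · exact hg (hU.eq_one_of_mem hgz (hzx ▸ hyx) hy)
      · exact hg (hU.eq_one_of_mem hgz (Ne.symm hzx) hx)
    rw [h1, h2]; norm_num

omit hU in
theorem fixCount_one {q : ℕ} (hΩ : Fintype.card Ω = q + 1) : fixCount Ω (1 : G) = q + 1 := by
  simp [fixCount, hΩ]

omit hU in
theorem rootCount_one {q : ℕ} (hΩ : Fintype.card Ω = q + 1) : rootCount U 1 = q + 1 := by
  simp [rootCount, hΩ]

end IsRootFamily

/-- The number of elements fixing each of two distinct points is `s`, whichever the points. -/
def HasPairCount (G Ω : Type*) [Group G] [Fintype G] [MulAction G Ω] [DecidableEq Ω] (s : ℕ) :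
    Prop :=
  ∀ a c b d : Ω, a ≠ c → b ≠ d → #{g : G | g • a = b ∧ g • c = d} = s

variable {q s : ℕ} (hq : 2 ≤ q) (hΩ : Fintype.card Ω = q + 1) (hs : HasPairCount G Ω s)

include hs in
theorem HasPairCount.sum_eq {a c b d : Ω} (h : a ≠ c) (h' : b ≠ d) :
    (∑ g : G, if g • a = b ∧ g • c = d then (1 : ℝ) else 0) = s := by
  rw [sum_boole, hs a c b d h h']

theorem sum_pair_eq_zero {a c b d : Ω} (h : ¬ (a = c ↔ b = d)) :
    (∑ g : G, if g • a = b ∧ g • c = d then (1 : ℝ) else 0) = 0 := by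
  refine sum_eq_zero fun g _ => ?_
  rw [if_neg]
  rintro ⟨rfl, rfl⟩
  exact h (smul_left_cancel_iff g).symm

include hq hΩ hs in
theorem HasPairCount.sum_smul_eq (y z : Ω) :
    (∑ g : G, if g • y = z then (1 : ℝ) else 0) = q * s := by
  have : Nontrivial Ω := Fintype.one_lt_card_iff_nontrivial.1 (by omega)
  obtain ⟨a, ha⟩ := exists_ne y
  have h (g : G) : (if g • y = z then (1 : ℝ) else 0) =
      ∑ w : Ω, if g • y = z ∧ g • a = w then 1 else 0 := by
    by_cases hg : g • y = z <;> simp [hg]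
  simp_rw [h]
  rw [sum_comm, sum_eq_add_card_mul (r := s) (a := 0) hΩ z]
  · ring
  · exact sum_pair_eq_zero (by simp [ha.symm])
  · intro w hw
    exact hs.sum_eq ha.symm hw.symm

theorem sum_erase_erase {y z : Ω} (hyz : y ≠ z) (hΩ : Fintype.card Ω = q + 1) {f : Ω → ℝ} {r : ℝ}
    (hy : f y = 0) (hz : f z = 0) (h : ∀ x, x ≠ y → x ≠ z → f x = r) :
    ∑ x, f x = (q - 1) * r := by
  rw [← add_sum_erase _ _ (mem_univ y), ← add_sum_erase _ _ (mem_erase.2 ⟨hyz.symm, mem_univ z⟩),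
    hy, hz, sum_congr rfl (g := fun _ => r)]
  · have h2 : 1 ≤ q := by
      have : Nontrivial Ω := ⟨y, z, hyz⟩
      have := Fintype.one_lt_card (α := Ω)
      omega
    simp [card_erase_of_mem, hyz.symm, hΩ, Nat.cast_sub h2]
  · intro x hx
    simp only [mem_erase] at hx
    exact h x hx.2.1 hx.1

include hq hΩ hs in
theorem HasPairCount.sum_fixCount (y z : Ω) :
    (∑ g : G, if g • y = z then fixCount Ω g else 0) =
      (q - 1) * s + if y = z then ((q : ℝ) + 1) * s else 0 := by
  have h (g : G) : (if g • y = z then fixCount Ω g else 0) =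
      ∑ x : Ω, if g • y = z ∧ g • x = x then 1 else 0 := by
    by_cases hg : g • y = z <;> simp [hg, fixCount]
  simp_rw [h]
  rw [sum_comm]
  split_ifs with hyz
  · subst hyz
    rw [sum_eq_add_card_mul (r := s) (a := q * s) hΩ y]
    · ring
    · simp only [and_self, hs.sum_smul_eq hq hΩ]
    · intro x hx
      exact hs.sum_eq hx.symm hx.symm
  · rw [sum_erase_erase hyz hΩ (r := s)]
    · ring
    · exact sum_pair_eq_zero (by simp [Ne.symm hyz])
    · exact sum_pair_eq_zero (by simp [hyz])
    · intro x hxy hxz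
      exact hs.sum_eq hxy.symm hxz.symm

include hq hΩ in
theorem IsRootFamily.sum_rootCount {U : Ω → Subgroup G} (hU : IsRootFamily U) (y z : Ω) :
    (∑ g : G, if g • y = z then rootCount U g else 0) =
      (q - 1) + if y = z then (q : ℝ) + 1 else 0 := by
  classical
  have h (g : G) : (if g • y = z then rootCount U g else 0) =
      ∑ x : Ω, if g ∈ U x ∧ g • y = z then 1 else 0 := by
    by_cases hg : g • y = z <;> simp [hg, rootCount]
  simp_rw [h]
  rw [sum_comm]
  split_ifs with hyz
  · subst hyz
    rw [sum_eq_add_card_mul (r := 1) (a := q) hΩ y]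
    · ring
    · have h1 (g : G) : (g ∈ U y ∧ g • y = y) ↔ g ∈ U y :=
        and_iff_left_of_imp (hU.smul_eq y g)
      simp only [h1, hU.sum_mem hq hΩ]
    · intro x hx
      exact hU.card_mem_and_smul_eq hx.symm hx.symm
  · rw [sum_erase_erase hyz hΩ (r := 1)]
    · ring
    · refine sum_eq_zero fun g _ => if_neg ?_
      rintro ⟨hg, rfl⟩
      exact hyz (hU.smul_eq y g hg).symm
    · refine sum_eq_zero fun g _ => if_neg ?_
      rintro ⟨hg, hgy⟩
      exact hyz (smul_left_cancel g (hgy.trans (hU.smul_eq z g hg).symm))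
    · intro x hxy hxz
      exact hU.card_mem_and_smul_eq hxy.symm hxz.symm

end Counting

end EKR

namespace EKR

open Finset Module

/-! ### A trace bound for the sum of the root subgroups. -/

section Trace

variable {G Ω V : Type*} [Group G] [Fintype G] [MulAction G Ω] [Fintype Ω]
  [AddCommGroup V] [Module ℝ V] [FiniteDimensional ℝ V]

open Classical in
-- The operator is `|H|` times the averaging projection onto the `H`-invariants.
theorem trace_sum_subgroup (ρ : Representation ℝ G V) (H : Subgroup G) :
    LinearMap.trace ℝ V (∑ g : G, if g ∈ H then ρ g else 0) =
      Nat.card H * finrank ℝ (Representation.invariants (MonoidHom.comp ρ H.subtype)) := by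
  have hH : (Fintype.card H : ℝ) ≠ 0 := Nat.cast_ne_zero.2 Fintype.card_ne_zero
  let σ : Representation ℝ H V := MonoidHom.comp ρ H.subtype
  let _ : Invertible (Fintype.card H : ℝ) := invertibleOfNonzero hH
  have h := σ.isProj_averageMap.trace
  have h2 : (∑ g : G, if g ∈ H then ρ g else 0) = (Fintype.card H : ℝ) • σ.averageMap := by
    rw [Representation.averageMap, GroupAlgebra.average]
    simp only [map_smul, map_sum, MonoidAlgebra.of_apply, Representation.asAlgebraHom_single_one,
      smul_smul, mul_invOf_self, one_smul]
    rw [← sum_filter]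
    exact (sum_subtype _ (by simp) _)
  rw [h2, map_smul, h, Nat.card_eq_fintype_card, smul_eq_mul]

open Classical in
/-- The scalar by which the sum of the root subgroups acts on a representation without invariants
is at most half of its value on the trivial representation. -/
theorem IsRootFamily.scalar_le {U : Ω → Subgroup G} (hU : IsRootFamily U) {q : ℕ}
    (hΩ : Fintype.card Ω = q + 1) (hcard : ∀ x, Nat.card (U x) = q)
    (ρ : Representation ℝ G V) (hρ : ρ.invariants = ⊥) [Nontrivial V] {μ : ℝ}
    (hμ : ∑ x, ∑ g : G, (if g ∈ U x then ρ g else 0) = μ • (1 : End ℝ V)) :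
    2 * μ ≤ q * (q + 1) := by
  let d (x : Ω) : ℝ := finrank ℝ (Representation.invariants (MonoidHom.comp ρ (U x).subtype))
  have htr : q * ∑ x, d x = μ * finrank ℝ V := by
    have := congrArg (LinearMap.trace ℝ V) hμ
    rw [map_sum, map_smul, LinearMap.trace_one] at this
    simpa only [trace_sum_subgroup, hcard, ← mul_sum, d, smul_eq_mul] using this
  -- A vector fixed by `U x` and `U y` is fixed by the group they generate, which is everything; so
  -- the two fixed spaces meet in zero.
  have hpair (x y : Ω) (hxy : x ≠ y) : d x + d y ≤ finrank ℝ V := by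
    have hdisj : Disjoint (Representation.invariants (MonoidHom.comp ρ (U x).subtype))
        (Representation.invariants (MonoidHom.comp ρ (U y).subtype)) := by
      rw [disjoint_iff_inf_le, ← hρ]
      rintro v ⟨hx, hy⟩ g
      let K : Subgroup G :=
        { carrier := {g | ρ g v = v}
          one_mem' := by simp
          mul_mem' := fun {a b} ha hb => by
            simp only [Set.mem_ofPred_eq] at ha hb ⊢
            rw [map_mul, Module.End.mul_apply, hb, ha]
          inv_mem' := fun {a} ha => by
            simp only [Set.mem_ofPred_eq] at ha ⊢
            nth_rewrite 1 [← ha]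
            simp }
      have hK : U x ⊔ U y ≤ K := sup_le (fun g hg => hx ⟨g, hg⟩) (fun g hg => hy ⟨g, hg⟩)
      rw [hU.sup_eq_top hxy] at hK
      exact hK (Subgroup.mem_top g)
    have := Submodule.finrank_add_finrank_le_of_disjoint hdisj
    simp only [d]
    exact_mod_cast this
  -- Summing over ordered pairs shows that the fixed spaces have average dimension at most half of
  -- `finrank ℝ V`.
  have hsum : ∑ x, ∑ y ∈ univ.erase x, (d x + d y) ≤ (q + 1) * q * finrank ℝ V := by
    calc _ ≤ ∑ x : Ω, ∑ y ∈ univ.erase x, (finrank ℝ V : ℝ) :=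
          sum_le_sum fun x _ => sum_le_sum fun y hy => hpair x y (ne_of_mem_erase hy).symm
      _ = _ := by simp [hΩ]; ring
  have hsum' : ∑ x, ∑ y ∈ univ.erase x, (d x + d y) = 2 * q * ∑ x, d x := by
    have h (x : Ω) : ∑ y ∈ univ.erase x, (d x + d y) = (q - 1) * d x + ∑ y, d y := by
      rw [sum_add_distrib, ← add_sum_erase _ d (mem_univ x)]
      simp [hΩ]
      ring
    simp_rw [h, sum_add_distrib, ← mul_sum]
    simp [hΩ]
    ring
  have hpos : (0 : ℝ) < finrank ℝ V := by exact_mod_cast finrank_pos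
  refine le_of_mul_le_mul_right ?_ hpos
  nlinarith

end Trace

end EKR

namespace EKR

open Finset Module Matrix

/-! ### The weight matrix and its positivity. -/

section Weight

variable {G Ω : Type*} [Group G] [Fintype G] [MulAction G Ω] [Fintype Ω] [DecidableEq Ω]
  {U : Ω → Subgroup G} {q s : ℕ}

/-- The number of derangements carrying a given point to a given other point. -/
noncomputable def derangementDegree (q s : ℕ) : ℝ := ((s : ℝ) * (q + 1) - (q - 1)) / 2

open Classical in
/-- The class function with vanishing row sums which is constant on the non-identity elements
having a fixed point. -/
noncomputable def weight (U : Ω → Subgroup G) (q s : ℕ) (g : G) : ℝ :=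
  (if g = 1 then q + derangementDegree q s else 0) - fixCount Ω g / 2 - rootCount U g / 2 +
    (1 - derangementDegree q s / (q * s))

theorem weight_inv (g : G) : weight U q s g⁻¹ = weight U q s g := by
  classical
  rw [weight, weight, fixCount_inv, rootCount_inv, if_congr inv_eq_one rfl rfl]

theorem weight_conj (hU : IsRootFamily U) (h g : G) :
    weight U q s (h * g * h⁻¹) = weight U q s g := by
  classical
  rw [weight, weight, fixCount_conj, hU.rootCount_conj, if_congr conj_eq_one_iff rfl rfl]

theorem weight_one (hΩ : Fintype.card Ω = q + 1) : weight U q s (1 : G) =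
    derangementDegree q s - derangementDegree q s / (q * s) := by
  rw [weight, IsRootFamily.fixCount_one hΩ, IsRootFamily.rootCount_one hΩ, if_pos rfl]
  ring

theorem weight_of_fixes (hU : IsRootFamily U) {g : G} (hg : g ≠ 1) {x : Ω} (hx : g • x = x) :
    weight U q s g = - (derangementDegree q s / (q * s)) := by
  have := hU.fixCount_add_rootCount hg hx
  rw [weight, if_neg hg]
  linarith

variable (hU : IsRootFamily U) (hq : 2 ≤ q) (hs0 : 1 ≤ s) (hΩ : Fintype.card Ω = q + 1)
  (hs : HasPairCount G Ω s)

include hU hq hs0 hΩ hs in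
-- This forces the constants in `weight`: the case `y ≠ z` determines `derangementDegree`, and the
-- case `y = z` then fixes the coefficient at the identity.
theorem sum_weight_smul_eq (y z : Ω) :
    (∑ g : G, if g • y = z then weight U q s g else 0) = 0 := by
  classical
  have hsplit (g : G) : (if g • y = z then weight U q s g else 0) =
      (if g = 1 then (if y = z then q + derangementDegree q s else 0) else 0)
      - (if g • y = z then fixCount Ω g else 0) / 2
      - (if g • y = z then rootCount U g else 0) / 2 +
      (1 - derangementDegree q s / (q * s)) * (if g • y = z then 1 else 0) := by
    by_cases h1 : g = 1
    · subst h1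
      by_cases hy : y = z <;> simp [weight, hy]
    · by_cases hy : g • y = z <;> simp [weight, hy, h1]
  simp_rw [hsplit]
  rw [sum_add_distrib, sum_sub_distrib, sum_sub_distrib, ← sum_div, ← sum_div, ← mul_sum,
    hs.sum_smul_eq hq hΩ, hs.sum_fixCount hq hΩ, hU.sum_rootCount hq hΩ,
    sum_ite_eq' univ (1 : G)]
  have hq' : (q : ℝ) ≠ 0 := by positivity
  have hs' : (s : ℝ) ≠ 0 := by positivity
  have h3 : derangementDegree q s / (q * s) * (q * s) = derangementDegree q s :=
    div_mul_cancel₀ _ (mul_ne_zero hq' hs')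
  rw [sub_mul (1 : ℝ) (_ / _), h3, derangementDegree, if_pos (mem_univ _)]
  split_ifs <;> ring

/-- The matrix of convolution by the weight function. -/
noncomputable def weightMatrix (U : Ω → Subgroup G) (q s : ℕ) : Matrix G G ℝ :=
  Matrix.of fun π σ => weight U q s (π * σ⁻¹)

theorem isHermitian_weightMatrix : (weightMatrix U q s).IsHermitian := by
  ext π σ
  simp [weightMatrix, ← weight_inv (g := σ * π⁻¹)]

theorem weightMatrix_mulVec_apply (f : G → ℝ) (π : G) :
    (weightMatrix U q s *ᵥ f) π = ∑ σ, weight U q s (π * σ⁻¹) * f σ := rfl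

/-- The functions on `G` with zero sum over each set `{g | g • x = y}`. -/
def balanced (G Ω : Type*) [Group G] [Fintype G] [MulAction G Ω] [DecidableEq Ω] :
    Submodule ℝ (G → ℝ) where
  carrier := {f | ∀ x y : Ω, (∑ g : G, if g • x = y then f g else 0) = 0}
  zero_mem' := by simp
  add_mem' {f f'} hf hf' x y := by
    simp only [Pi.add_apply, ite_add_zero, sum_add_distrib, hf x y, hf' x y, add_zero]
  smul_mem' c f hf x y := by
    have := congrArg (c * ·) (hf x y)
    simpa [mul_sum] using this

theorem sum_eq_zero_of_mem_balanced [Nonempty Ω] {f : G → ℝ} (hf : f ∈ balanced G Ω) :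
    ∑ g, f g = 0 := by
  obtain ⟨x⟩ := ‹Nonempty Ω›
  have h (g : G) : f g = ∑ y : Ω, if g • x = y then f g else 0 := by simp
  rw [sum_congr rfl fun g _ => h g, sum_comm]
  exact sum_eq_zero fun y _ => hf x y

include hU hq hs0 hΩ hs in
-- Consequently an eigenvector with nonzero eigenvalue is balanced.
theorem mulVec_mem_balanced (f : G → ℝ) : weightMatrix U q s *ᵥ f ∈ balanced G Ω := by
  intro x y
  have h (π : G) : (if π • x = y then (weightMatrix U q s *ᵥ f) π else 0) =
      ∑ σ, (if π • x = y then weight U q s (π * σ⁻¹) else 0) * f σ := by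
    split_ifs <;> simp [weightMatrix_mulVec_apply]
  simp_rw [h]
  rw [sum_comm]
  refine sum_eq_zero fun σ _ => ?_
  rw [← sum_mul]
  refine mul_eq_zero_of_left ?_ _
  refine Eq.trans ?_ (sum_weight_smul_eq hU hq hs0 hΩ hs (σ • x) y)
  exact Fintype.sum_equiv (Equiv.mulRight σ⁻¹) _ _ fun π => by simp [mul_smul]

include hU hq hs0 hΩ hs in
theorem sum_weight_mul_smul_eq (π : G) (x y : Ω) :
    (∑ σ : G, if σ • x = y then weight U q s (π * σ⁻¹) else 0) = 0 := by
  refine Eq.trans ?_ (sum_weight_smul_eq hU hq hs0 hΩ hs y (π • x))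
  refine Fintype.sum_equiv ((Equiv.inv G).trans (Equiv.mulLeft π)) _ _ fun σ => ?_
  simp [mul_smul, inv_smul_eq_iff, eq_comm (a := y)]

/-- The left regular representation on functions. -/
def leftTranslation (G : Type*) [Group G] : Representation ℝ G (G → ℝ) where
  toFun h := LinearMap.funLeft ℝ ℝ (h⁻¹ * ·)
  map_one' := by ext; simp [LinearMap.funLeft]
  map_mul' g h := by ext; simp [LinearMap.funLeft, mul_assoc]

theorem leftTranslation_apply (h : G) (f : G → ℝ) (π : G) :
    leftTranslation G h f π = f (h⁻¹ * π) := rfl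

theorem leftTranslation_mem_balanced (h : G) {f : G → ℝ} (hf : f ∈ balanced G Ω) :
    leftTranslation G h f ∈ balanced G Ω := by
  intro x y
  refine Eq.trans ?_ (hf x (h⁻¹ • y))
  refine Fintype.sum_equiv (Equiv.mulLeft h⁻¹) _ _ fun π => ?_
  simp [leftTranslation_apply, mul_smul]

include hU in
-- Convolution by a class function commutes with translations, so the eigenspaces are
-- subrepresentations.
theorem mulVec_leftTranslation (h : G) (f : G → ℝ) :
    weightMatrix U q s *ᵥ leftTranslation G h f =
      leftTranslation G h (weightMatrix U q s *ᵥ f) := by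
  ext π
  rw [leftTranslation_apply, weightMatrix_mulVec_apply, weightMatrix_mulVec_apply]
  refine Fintype.sum_equiv (Equiv.mulLeft h⁻¹) _ _ fun σ => ?_
  rw [leftTranslation_apply, Equiv.coe_mulLeft, ← weight_conj hU h⁻¹]
  simp [mul_assoc]

theorem sum_fixCount_mul_eq_zero {f : G → ℝ} (hf : f ∈ balanced G Ω) (π : G) :
    ∑ σ, fixCount Ω (π * σ⁻¹) * f σ = 0 := by
  have h (σ : G) : fixCount Ω (π * σ⁻¹) * f σ =
      ∑ x : Ω, if σ • (π⁻¹ • x) = x then f σ else 0 := by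
    rw [fixCount, sum_mul]
    refine sum_congr rfl fun x _ => ?_
    rw [ite_mul, one_mul, zero_mul]
    refine if_congr ?_ rfl rfl
    rw [mul_smul, ← eq_inv_smul_iff, inv_smul_eq_iff, eq_comm]
  simp_rw [h]
  rw [sum_comm]
  exact sum_eq_zero fun x _ => hf _ x

open Classical in
-- This turns the `rootCount` term of the weight into the operator to which the trace bound applies.
theorem sum_rootCount_mul (f : G → ℝ) (π : G) :
    ∑ σ, rootCount U (π * σ⁻¹) * f σ =
      ∑ x, ∑ g : G, if g ∈ U x then leftTranslation G g f π else 0 := by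
  simp only [rootCount, sum_mul]
  rw [sum_comm]
  refine sum_congr rfl fun x _ => ?_
  refine Fintype.sum_equiv ((Equiv.inv G).trans (Equiv.mulLeft π)) _ _ fun σ => ?_
  simp [leftTranslation_apply]

open Classical in
theorem mulVec_apply_of_mem_balanced [Nonempty Ω] {f : G → ℝ} (hf : f ∈ balanced G Ω) (π : G) :
    (weightMatrix U q s *ᵥ f) π = (q + derangementDegree q s) * f π -
      (∑ x, ∑ g : G, if g ∈ U x then leftTranslation G g f π else 0) / 2 := by
  rw [weightMatrix_mulVec_apply]
  simp only [weight, sub_mul, add_mul, sum_add_distrib, sum_sub_distrib, div_mul_eq_mul_div,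
    ← sum_div, ← mul_sum, sum_fixCount_mul_eq_zero hf, sum_eq_zero_of_mem_balanced hf,
    sum_rootCount_mul]
  simp [mul_inv_eq_one, add_mul]

include hU hq hΩ in
theorem card_rootSubgroup (x : Ω) : Nat.card (U x) = q := by
  classical
  have := hU.sum_mem hq hΩ x
  rw [sum_boole] at this
  rw [← Nat.cast_inj (R := ℝ), ← this, Nat.card_eq_fintype_card, Fintype.card_subtype]

include hU hq hs0 hΩ hs in
/-- On balanced functions the weight matrix has only positive eigenvalues. -/
theorem eq_zero_of_mulVec_eq_smul (hs2 : q ≤ 2 * s + 1) {f : G → ℝ} (hf : f ∈ balanced G Ω)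
    {t : ℝ} (ht : t ≤ 0) (hft : weightMatrix U q s *ᵥ f = t • f) : f = 0 := by
  classical
  have : Nonempty Ω := Fintype.card_pos_iff.1 (by omega)
  -- On the balanced part of the `t`-eigenspace the root subgroup sum acts as a scalar.
  let E : Subrepresentation (leftTranslation G) :=
    { toSubmodule := balanced G Ω ⊓ LinearMap.eqLocus (weightMatrix U q s).mulVecLin (t • LinearMap.id)
      apply_mem_toSubmodule := by
        rintro g v ⟨h1, h2⟩
        refine ⟨leftTranslation_mem_balanced g h1, ?_⟩
        have h2' : weightMatrix U q s *ᵥ v = t • v := h2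
        change weightMatrix U q s *ᵥ _ = t • _
        rw [mulVec_leftTranslation hU, h2', map_smul]
        rfl }
  have hE {v : G → ℝ} (hv : v ∈ E.toSubmodule) : weightMatrix U q s *ᵥ v = t • v := hv.2
  by_contra hne
  have hfE : f ∈ E.toSubmodule := ⟨hf, hft⟩
  have : Nontrivial E.toSubmodule := ⟨⟨f, hfE⟩, 0, fun h => hne (congrArg Subtype.val h)⟩
  -- An invariant function is constant, and a balanced constant vanishes because `q * s` is nonzero.
  have hinv : E.toRepresentation.invariants = ⊥ := by
    rw [eq_bot_iff]
    rintro ⟨v, hv⟩ hinv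
    have hconst (g : G) : v g = v 1 := by
      have := congrFun (congrArg Subtype.val (hinv g⁻¹)) 1
      simpa [Subrepresentation.toRepresentation, leftTranslation_apply] using this
    have hx := hv.1 (Classical.arbitrary Ω) (Classical.arbitrary Ω)
    have h2 := hs.sum_smul_eq hq hΩ (Classical.arbitrary Ω) (Classical.arbitrary Ω)
    simp_rw [hconst] at hx
    simp only [← mul_boole _ (v 1), ← mul_sum, h2] at hx
    have h3 : v 1 = 0 := by
      have : (0 : ℝ) < q * s := by positivity
      exact (mul_eq_zero.1 hx).resolve_right this.ne'
    rw [Submodule.mem_bot, Subtype.ext_iff]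
    ext g
    simp [hconst g, h3]
  have hμ : ∑ x, ∑ g : G, (if g ∈ U x then E.toRepresentation g else 0) =
      (2 * (q + derangementDegree q s - t)) • (1 : End ℝ E.toSubmodule) := by
    refine LinearMap.ext fun v => Subtype.ext (funext fun π => ?_)
    have h1 := congrFun (hE v.2) π
    rw [mulVec_apply_of_mem_balanced v.2.1] at h1
    have h2 : ((∑ x, ∑ g : G, (if g ∈ U x then E.toRepresentation g else 0)) v : E.toSubmodule).1 π
        = ∑ x, ∑ g : G, if g ∈ U x then leftTranslation G g v.1 π else 0 := by
      simp only [LinearMap.sum_apply, Submodule.coe_sum, Finset.sum_apply]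
      refine sum_congr rfl fun x _ => sum_congr rfl fun g _ => ?_
      split_ifs <;> rfl
    rw [h2]
    simp only [Pi.smul_apply, smul_eq_mul] at h1
    simp only [LinearMap.smul_apply, End.one_apply, SetLike.val_smul, Pi.smul_apply, smul_eq_mul]
    linarith
  have key := hU.scalar_le hΩ (card_rootSubgroup hU hq hΩ) _ hinv hμ
  have h1 : (q : ℝ) ≤ 2 * s + 1 := by exact_mod_cast hs2
  have h2 : (2 : ℝ) ≤ q := by exact_mod_cast hq
  rw [derangementDegree] at key
  -- The trace bound reads `4 (q + d - t) ≤ q (q + 1)`, while `q ≤ 2 s + 1` gives `4 d ≥ (q - 1) ^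
  -- 2`; hence `4 t ≥ q + 1`, against `t ≤ 0`.
  nlinarith

include hU hq hs0 hΩ hs in
theorem posSemidef_weightMatrix (hs2 : q ≤ 2 * s + 1) : (weightMatrix U q s).PosSemidef := by
  classical
  have hM : (weightMatrix U q s).IsHermitian := isHermitian_weightMatrix
  rw [hM.posSemidef_iff_eigenvalues_nonneg]
  intro i
  by_contra! hlt
  have hlt : hM.eigenvalues i < 0 := hlt
  have hev := hM.mulVec_eigenvectorBasis i
  have hmem : ⇑(hM.eigenvectorBasis i) ∈ balanced G Ω := by
    have := Submodule.smul_mem (balanced G Ω) (hM.eigenvalues i)⁻¹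
      (mulVec_mem_balanced hU hq hs0 hΩ hs (hM.eigenvectorBasis i))
    rw [hev] at this
    simpa [smul_smul, inv_mul_cancel₀ hlt.ne] using this
  have h0 := eq_zero_of_mulVec_eq_smul hU hq hs0 hΩ hs hs2 hmem hlt.le hev
  refine (hM.eigenvectorBasis.orthonormal.ne_zero i) ?_
  ext j
  simpa using congrFun h0 j

end Weight

end EKR

namespace EKR

open Finset Module Matrix

/-! ### The ratio bound and its equality case. -/

section Ratio

variable {G Ω : Type*} [Group G] [Fintype G] [MulAction G Ω] [Fintype Ω] [DecidableEq Ω]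
  {U : Ω → Subgroup G} {q s : ℕ}
  (hU : IsRootFamily U) (hq : 2 ≤ q) (hs0 : 1 ≤ s) (hΩ : Fintype.card Ω = q + 1)
  (hs : HasPairCount G Ω s) (hs2 : q ≤ 2 * s + 1)

include hq hs0 in
theorem derangementDegree_pos : 0 < derangementDegree q s := by
  have h1 : (2 : ℝ) ≤ q := by exact_mod_cast hq
  have h2 : (1 : ℝ) ≤ s := by exact_mod_cast hs0
  rw [derangementDegree]
  nlinarith

include hU hΩ in
-- No quotient `π * σ⁻¹` from `S` is a derangement, so on `S × S` the matrix reduces to `d I - (d /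
-- (q s)) J`.
theorem indicator_dotProduct_mulVec {S : Finset G} (hS : IsIntersecting G Ω S) :
    star ((S : Set G).indicator 1) ⬝ᵥ (weightMatrix U q s *ᵥ (S : Set G).indicator 1) =
      derangementDegree q s * #S - derangementDegree q s / (q * s) * (#S : ℝ) ^ 2 := by
  classical
  have h1 (π : G) (hπ : π ∈ S) : (weightMatrix U q s *ᵥ (S : Set G).indicator 1) π =
      derangementDegree q s - derangementDegree q s / (q * s) * #S := by
    have h2 (σ : G) (hσ : σ ∈ S) : weight U q s (π * σ⁻¹) =
        (if π = σ then derangementDegree q s else 0) - derangementDegree q s / (q * s) := by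
      split_ifs with h
      · rw [h, mul_inv_cancel, weight_one hΩ]
      · obtain ⟨x, hx⟩ := hS π hπ σ hσ
        rw [weight_of_fixes hU (by rwa [Ne, mul_inv_eq_one]) hx, zero_sub]
    rw [weightMatrix_mulVec_apply]
    simp only [Set.indicator_apply, mem_coe, Pi.one_apply, mul_ite, mul_one, mul_zero]
    rw [← sum_filter, filter_mem_eq_inter, univ_inter, sum_congr rfl h2, sum_sub_distrib,
      sum_ite_eq, if_pos hπ, sum_const, nsmul_eq_mul]
    ring
  simp only [dotProduct, star_trivial]
  simp only [Set.indicator_apply, mem_coe, Pi.one_apply, ite_mul, one_mul, zero_mul]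
  rw [← sum_filter, filter_mem_eq_inter, univ_inter, sum_congr rfl h1, sum_const, nsmul_eq_mul]
  ring

include hU hq hs0 hΩ hs hs2 in
theorem IsIntersecting.card_le {S : Finset G} (hS : IsIntersecting G Ω S) : #S ≤ q * s := by
  have h := (posSemidef_weightMatrix hU hq hs0 hΩ hs hs2).dotProduct_mulVec_nonneg
    ((S : Set G).indicator 1)
  rw [indicator_dotProduct_mulVec hU hΩ hS] at h
  have hc := derangementDegree_pos hq hs0
  have hqs : (0 : ℝ) < q * s := by positivity
  rcases Nat.eq_zero_or_pos #S with h0 | h0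
  · rw [h0]; exact Nat.zero_le _
  have hS0 : (0 : ℝ) < #S := by exact_mod_cast h0
  have h2 : 0 ≤ (derangementDegree q s * #S / (q * s)) * (q * s - #S) := by
    refine h.trans_eq ?_
    field_simp
  have h3 := nonneg_of_mul_nonneg_right h2 (by positivity)
  have h4 : (#S : ℝ) ≤ q * s := by linarith
  exact_mod_cast h4

include hq hΩ hs in
theorem sum_smul_eq_fixCount (τ : G) (x y : Ω) :
    (∑ σ : G, if σ • x = y then fixCount Ω (σ⁻¹ * τ) else 0) =
      (q - 1) * s + if τ • x = y then ((q : ℝ) + 1) * s else 0 := by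
  have h := hs.sum_fixCount hq hΩ (τ⁻¹ • y) x
  rw [if_congr (show τ⁻¹ • y = x ↔ τ • x = y by rw [inv_smul_eq_iff, eq_comm]) rfl rfl] at h
  rw [← h]
  refine Fintype.sum_equiv ((Equiv.inv G).trans (Equiv.mulRight τ)) _ _ fun σ => ?_
  simp [mul_smul, inv_smul_eq_iff, eq_comm (a := y)]

include hU hq hs0 hΩ hs in
theorem sum_weight_mul_fixCount (π τ : G) :
    ∑ σ : G, weight U q s (π * σ⁻¹) * fixCount Ω (σ⁻¹ * τ) = 0 := by
  have h (σ : G) : weight U q s (π * σ⁻¹) * fixCount Ω (σ⁻¹ * τ) =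
      ∑ x : Ω, if σ • x = τ • x then weight U q s (π * σ⁻¹) else 0 := by
    simp only [fixCount, mul_sum, mul_ite, mul_one, mul_zero]
    refine sum_congr rfl fun x _ => if_congr ?_ rfl rfl
    rw [mul_smul, inv_smul_eq_iff, eq_comm]
  rw [sum_congr rfl fun σ _ => h σ, sum_comm]
  exact sum_eq_zero fun x _ => sum_weight_mul_smul_eq hU hq hs0 hΩ hs π x _

include hU hq hs0 hΩ hs in
theorem sum_weight_mul (π : G) : ∑ σ : G, weight U q s (π * σ⁻¹) = 0 := by
  have : Nonempty Ω := Fintype.card_pos_iff.1 (by omega)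
  have h (σ : G) : weight U q s (π * σ⁻¹) =
      ∑ y : Ω, if σ • Classical.arbitrary Ω = y then weight U q s (π * σ⁻¹) else 0 := by simp
  rw [sum_congr rfl fun σ _ => h σ, sum_comm]
  exact sum_eq_zero fun y _ => sum_weight_mul_smul_eq hU hq hs0 hΩ hs π _ y

include hU hq hs0 hΩ hs hs2 in
/-- A function annihilated by the weight matrix is a combination of the functions
`π ↦ fixCount Ω (π⁻¹ * τ)` and a constant. -/
theorem eq_of_mulVec_eq_zero {f : G → ℝ} (hf : weightMatrix U q s *ᵥ f = 0) (π : G) :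
    f π = (((q : ℝ) + 1) * s)⁻¹ * ∑ τ, fixCount Ω (π⁻¹ * τ) * f τ -
      (q - 1) / ((q + 1) * q * s) * ∑ τ, f τ := by
  -- The coefficients make `b` balanced. Over `{σ | σ • x = y}` the `fixCount` sum gives `(q + 1) s`
  -- times the sum of `f` there, plus `(q - 1) s ∑ f`; the constant term cancels the latter.
  let b (π : G) : ℝ := f π - (((q : ℝ) + 1) * s)⁻¹ * ∑ τ, fixCount Ω (π⁻¹ * τ) * f τ +
      (q - 1) / ((q + 1) * q * s) * ∑ τ, f τ
  have hq' : (q : ℝ) ≠ 0 := by positivity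
  have hq1 : (q : ℝ) + 1 ≠ 0 := by positivity
  have hs' : (s : ℝ) ≠ 0 := by positivity
  have hb : b ∈ balanced G Ω := by
    intro x y
    have h1 (σ : G) : (if σ • x = y then b σ else 0) =
        (if σ • x = y then f σ else 0) - (((q : ℝ) + 1) * s)⁻¹ *
          (∑ τ, (if σ • x = y then fixCount Ω (σ⁻¹ * τ) else 0) * f τ) +
        (q - 1) / ((q + 1) * q * s) * (∑ τ, f τ) * (if σ • x = y then 1 else 0) := by
      split_ifs <;> simp [b]
    rw [sum_congr rfl fun σ _ => h1 σ, sum_add_distrib, sum_sub_distrib, ← mul_sum, ← mul_sum,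
      hs.sum_smul_eq hq hΩ, sum_comm]
    simp_rw [← sum_mul, sum_smul_eq_fixCount hq hΩ hs]
    simp_rw [add_mul _ _ (f _), sum_add_distrib, ite_mul, zero_mul, ← mul_sum]
    have h2 : (∑ τ : G, if τ • x = y then ((q : ℝ) + 1) * s * f τ else 0) =
        (q + 1) * s * ∑ τ : G, if τ • x = y then f τ else 0 := by
      simp only [mul_sum, mul_ite, mul_zero]
    rw [h2]
    field_simp
    ring
  -- The matrix kills both correction terms as well as `f`, so `b` is a balanced kernel vector and
  -- must vanish.
  have hMb : weightMatrix U q s *ᵥ b = (0 : ℝ) • b := by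
    rw [zero_smul]
    ext π
    have h0 := congrFun hf π
    rw [weightMatrix_mulVec_apply] at h0 ⊢
    simp only [b, mul_add, mul_sub, sum_add_distrib, sum_sub_distrib, h0]
    rw [← sum_mul, sum_weight_mul hU hq hs0 hΩ hs]
    simp_rw [mul_sum]
    rw [sum_comm]
    have h3 (τ σ : G) : weight U q s (π * σ⁻¹) *
        ((((q : ℝ) + 1) * s)⁻¹ * (fixCount Ω (σ⁻¹ * τ) * f τ)) =
        (weight U q s (π * σ⁻¹) * fixCount Ω (σ⁻¹ * τ)) * ((((q : ℝ) + 1) * s)⁻¹ * f τ) := by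
      ring
    simp_rw [h3, ← sum_mul, sum_weight_mul_fixCount hU hq hs0 hΩ hs]
    simp
  have h := congrFun (eq_zero_of_mulVec_eq_smul hU hq hs0 hΩ hs hs2 hb le_rfl hMb) π
  simp only [b, Pi.zero_apply] at h
  linarith

include hU hq hs0 hΩ hs hs2 in
theorem IsIntersecting.mulVec_eq_zero {S : Finset G} (hS : IsIntersecting G Ω S)
    (hcard : #S = q * s) : weightMatrix U q s *ᵥ (S : Set G).indicator 1 = 0 := by
  rw [← (posSemidef_weightMatrix hU hq hs0 hΩ hs hs2).dotProduct_mulVec_zero_iff,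
    indicator_dotProduct_mulVec hU hΩ hS, hcard]
  push_cast
  field_simp
  ring

include hq hΩ hs in
theorem HasPairCount.card_stabilizer (x : Ω) : Nat.card (MulAction.stabilizer G x) = q * s := by
  classical
  have h := hs.sum_smul_eq hq hΩ x x
  rw [sum_boole] at h
  rw [Nat.card_eq_fintype_card, ← Nat.cast_inj (R := ℝ), Nat.cast_mul, ← h]
  exact congrArg _ (Fintype.card_subtype _)

include hq hΩ hs in
theorem IsMaximumIntersecting.card_ge {S : Finset G} (hS : IsMaximumIntersecting G Ω S) :
    q * s ≤ #S := by
  classical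
  have : Nonempty Ω := Fintype.card_pos_iff.1 (by omega)
  let x : Ω := Classical.arbitrary Ω
  have h := hS.2 {g : G | g • x = x} fun π hπ σ hσ => ⟨x, by
    simp only [mem_filter, mem_univ, true_and] at hπ hσ
    rw [mul_smul, inv_smul_eq_iff.2 hσ.symm, hπ]⟩
  rw [← hs.card_stabilizer hq hΩ x, Nat.card_eq_fintype_card]
  exact (Fintype.card_subtype _).trans_le h

end Ratio

/-! ### The trivial and standard modules. -/

section Modules

variable {G Ω : Type*} [Group G] [Finite G] [MulAction G Ω]

theorem ofMulAction_character [Fintype Ω] [DecidableEq Ω] (g : G) :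
    (Representation.ofMulAction ℂ G Ω).character g = (fixCount Ω g : ℂ) := by
  rw [Representation.character,
    LinearMap.trace_eq_matrix_trace ℂ (.ofRepr (MonoidAlgebra.coeffLinearEquiv ℂ) : Basis Ω ℂ _),
    Matrix.trace]
  simp only [fixCount, Complex.ofReal_sum]
  refine sum_congr rfl fun x _ => ?_
  rw [Matrix.diag_apply, LinearMap.toMatrix_apply]
  simp [Representation.ofMulAction, Finsupp.single_apply, apply_ite Complex.ofReal]

theorem standardCharacter_apply [Fintype Ω] [DecidableEq Ω] (g : G) :
    standardCharacter G Ω g = (fixCount Ω g : ℂ) - 1 := by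
  rw [standardCharacter, ofMulAction_character]

theorem trivialCharacter_apply (g : G) : trivialCharacter G g = 1 := by
  simp [trivialCharacter, Representation.character]

theorem const_mem_trivialModule (a : ℂ) : (fun _ => a) ∈ trivialModule G := by
  have h : (idempotentMatrix G (trivialCharacter G)).col 1 ∈ trivialModule G :=
    Submodule.subset_span ⟨1, rfl⟩
  convert Submodule.smul_mem _ (a * Nat.card G) h using 1
  ext π
  have : (Nat.card G : ℂ) ≠ 0 := Nat.cast_ne_zero.2 Nat.card_pos.ne'
  simp [idempotentMatrix, trivialCharacter_apply, Matrix.col, this]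

theorem exists_const_of_mem_trivialModule {f : G → ℂ} (hf : f ∈ trivialModule G) :
    ∃ a : ℂ, f = fun _ => a := by
  induction hf using Submodule.span_induction with
  | mem f h =>
    obtain ⟨σ, rfl⟩ := h
    exact ⟨1 / Nat.card G, by ext; simp [idempotentMatrix, trivialCharacter_apply, Matrix.col]⟩
  | zero => exact ⟨0, rfl⟩
  | add f g _ _ hf hg =>
    obtain ⟨a, rfl⟩ := hf
    obtain ⟨b, rfl⟩ := hg
    exact ⟨a + b, rfl⟩
  | smul c f _ hf =>
    obtain ⟨a, rfl⟩ := hf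
    exact ⟨c * a, rfl⟩

theorem sum_eq_zero_of_mem_standardModule [Fintype G] [Fintype Ω] [DecidableEq Ω]
    (hfix : ∑ g : G, fixCount Ω g = Fintype.card G) {f : G → ℂ} (hf : f ∈ standardModule G Ω) :
    ∑ g, f g = 0 := by
  induction hf using Submodule.span_induction with
  | mem f h =>
    obtain ⟨σ, rfl⟩ := h
    simp only [idempotentMatrix, Matrix.col, Matrix.transpose_apply, Matrix.of_apply, ← mul_sum]
    refine mul_eq_zero_of_right _ ?_
    have h1 : ∑ π : G, standardCharacter G Ω (π⁻¹ * σ) = ∑ g : G, standardCharacter G Ω g :=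
      Fintype.sum_equiv ((Equiv.inv G).trans (Equiv.mulRight σ)) _ _ fun π => rfl
    rw [h1]
    simp only [standardCharacter_apply, sum_sub_distrib, ← Complex.ofReal_sum, hfix]
    simp
  | zero => simp
  | add f g _ _ hf hg => simp [sum_add_distrib, hf, hg]
  | smul c f _ hf => simp [← mul_sum, hf]

/-- The trivial module consists of constants, while `hfix` (Burnside's count for one orbit) makes
every function in the standard module sum to zero. -/
theorem disjoint_trivialModule_standardModule [Fintype G] [Fintype Ω] [DecidableEq Ω]
    (hfix : ∑ g : G, fixCount Ω g = Fintype.card G) :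
    Disjoint (trivialModule G) (standardModule G Ω) := by
  rw [Submodule.disjoint_def]
  intro f h1 h2
  obtain ⟨a, rfl⟩ := exists_const_of_mem_trivialModule h1
  have := sum_eq_zero_of_mem_standardModule hfix h2
  have ha : a = 0 := by simpa using this
  subst ha
  rfl

theorem fixCount_mem_sup [Fintype Ω] [DecidableEq Ω] (hΩ : 2 ≤ Fintype.card Ω) (τ : G) :
    (fun π : G => (fixCount Ω (π⁻¹ * τ) : ℂ)) ∈ trivialModule G ⊔ standardModule G Ω := by
  have h : (idempotentMatrix G (standardCharacter G Ω)).col τ ∈ standardModule G Ω :=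
    Submodule.subset_span ⟨τ, rfl⟩
  have hG : (Nat.card G : ℂ) ≠ 0 := Nat.cast_ne_zero.2 Nat.card_pos.ne'
  -- The standard character has degree `|Ω| - 1`, nonzero by `hΩ`; this allows the normalization of
  -- the column to be undone.
  have h1 : standardCharacter G Ω 1 ≠ 0 := by
    rw [standardCharacter_apply, fixCount, sub_ne_zero]
    simp only [one_smul, if_true, sum_const, card_univ, nsmul_eq_mul, mul_one]
    norm_cast
    omega
  convert Submodule.add_mem_sup (const_mem_trivialModule (G := G) 1)
    (Submodule.smul_mem _ (Nat.card G / standardCharacter G Ω 1) h) using 1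
  ext π
  simp only [Pi.add_apply, Pi.smul_apply, idempotentMatrix, Matrix.col, Matrix.transpose_apply,
    Matrix.of_apply, smul_eq_mul]
  rw [← mul_assoc, div_mul_div_cancel₀ h1, div_self hG, one_mul, standardCharacter_apply]
  ring

end Modules

/-! ### The abstract theorem for groups with a root family. -/

section Conclusion

variable {G Ω : Type*} [Group G] [Fintype G] [MulAction G Ω] [Fintype Ω] [DecidableEq Ω]
  {U : Ω → Subgroup G} {q s : ℕ}
  (hU : IsRootFamily U) (hq : 2 ≤ q) (hs0 : 1 ≤ s) (hΩ : Fintype.card Ω = q + 1)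
  (hs : HasPairCount G Ω s) (hs2 : q ≤ 2 * s + 1)

include hU hq hs0 hΩ hs hs2 in
theorem hasEKRProperty_of_isRootFamily : HasEKRProperty G Ω := by
  intro S hS
  have : Nonempty Ω := Fintype.card_pos_iff.1 (by omega)
  refine ⟨Classical.arbitrary Ω, ?_⟩
  rw [hs.card_stabilizer hq hΩ]
  exact hS.card_le hU hq hs0 hΩ hs hs2

include hq hΩ hs in
theorem HasPairCount.sum_fixCount_eq_card : ∑ g : G, fixCount Ω g = Fintype.card G := by
  have : Nonempty Ω := Fintype.card_pos_iff.1 (by omega)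
  simp only [fixCount]
  rw [sum_comm, sum_congr rfl fun x _ => hs.sum_smul_eq hq hΩ x x]
  have h (g : G) : (1 : ℝ) = ∑ y : Ω, if g • Classical.arbitrary Ω = y then 1 else 0 := by simp
  rw [← card_univ, cast_card, sum_congr rfl fun g _ => h g, sum_comm,
    sum_congr rfl fun y _ => hs.sum_smul_eq hq hΩ _ y]

include hU hq hs0 hΩ hs hs2 in
theorem characteristicVector_mem_of_isRootFamily {S : Finset G}
    (hS : IsMaximumIntersecting G Ω S) :
    characteristicVector G S ∈ trivialModule G ⊔ standardModule G Ω := by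
  have hcard : #S = q * s :=
    (hS.1.card_le hU hq hs0 hΩ hs hs2).antisymm (hS.card_ge hq hΩ hs)
  have h := eq_of_mulVec_eq_zero hU hq hs0 hΩ hs hs2
    (hS.1.mulVec_eq_zero hU hq hs0 hΩ hs hs2 hcard)
  set v : G → ℝ := (S : Set G).indicator 1 with hv
  have h2 : characteristicVector G S =
      (∑ τ, ((((q : ℝ) + 1) * s)⁻¹ * v τ : ℝ) • (fun π : G => (fixCount Ω (π⁻¹ * τ) : ℂ))) +
      fun _ => ((- ((q - 1) / ((q + 1) * q * s) * ∑ τ, v τ) : ℝ) : ℂ) := by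
    ext π
    have h3 : characteristicVector G S π = (v π : ℂ) := by
      by_cases hπ : π ∈ S <;> simp [characteristicVector, hv, hπ]
    rw [h3, h π, Pi.add_apply, Finset.sum_apply, sub_eq_add_neg, Complex.ofReal_add, mul_sum,
      Complex.ofReal_sum]
    congr 1
    refine sum_congr rfl fun τ _ => ?_
    simp
    ring
  rw [h2]
  refine add_mem (sum_mem fun τ _ => ?_) (Submodule.mem_sup_left (const_mem_trivialModule _))
  rw [← Complex.coe_smul]
  exact Submodule.smul_mem _ _ (fixCount_mem_sup (by omega) τ)

end Conclusion

end EKR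

namespace EKR

open Finset Projectivization Matrix.SpecialLinearGroup

/-! ### The root family of `PSL(2, F)`. -/

section PSL

variable {F : Type*} [Field F]

theorem mk_eq_mk_iff_cross {v w : Fin 2 → F} (hv : v ≠ 0) (hw : w ≠ 0) :
    Projectivization.mk F v hv = Projectivization.mk F w hw ↔ v 0 * w 1 = v 1 * w 0 := by
  rw [Projectivization.mk_eq_mk_iff']
  constructor
  · rintro ⟨a, rfl⟩
    simp
    ring
  · intro h
    have hw' : w 0 ≠ 0 ∨ w 1 ≠ 0 := by
      by_contra! h0
      exact hw (by ext i; fin_cases i <;> simp [h0])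
    rcases hw' with h0 | h1
    · refine ⟨v 0 / w 0, ?_⟩
      ext i; fin_cases i
      · simp [h0]
      · simp; field_simp; linear_combination h
    · refine ⟨v 1 / w 1, ?_⟩
      ext i; fin_cases i
      · simp; field_simp; linear_combination -h
      · simp [h1]

variable (F) in
/-- The point at infinity of the projective line. -/
def infPoint : ℙ F (Fin 2 → F) := Projectivization.mk F ![1, 0] (by simp)

/-- The finite points of the projective line. -/
def affPoint (t : F) : ℙ F (Fin 2 → F) := Projectivization.mk F ![t, 1] (by simp)

theorem affPoint_injective : Function.Injective (affPoint (F := F)) := by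
  intro s t h
  simpa [affPoint, mk_eq_mk_iff_cross] using h

theorem affPoint_ne_infPoint (t : F) : affPoint t ≠ infPoint F := by
  simp [affPoint, infPoint, mk_eq_mk_iff_cross]

theorem exists_affPoint {y : ℙ F (Fin 2 → F)} (hy : y ≠ infPoint F) : ∃ t, y = affPoint t := by
  induction y using Projectivization.ind with
  | _ v hv =>
    have h1 : v 1 ≠ 0 := by simpa [infPoint, mk_eq_mk_iff_cross, eq_comm] using hy
    refine ⟨v 0 / v 1, ?_⟩
    simp [affPoint, mk_eq_mk_iff_cross]
    field_simp

theorem coe_smul_infPoint_eq_iff (A : SL(2, F)) :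
    (A : PSL(2, F)) • infPoint F = infPoint F ↔ A.1 1 0 = 0 := by
  rw [Matrix.ProjectiveSpecialLinearGroup.smul_proj_mk, infPoint, Projectivization.smul_mk,
    mk_eq_mk_iff_cross]
  simp [Matrix.SpecialLinearGroup.smul_def, Matrix.mulVec, dotProduct, eq_comm]

theorem coe_smul_affPoint_eq_iff (A : SL(2, F)) (t t' : F) :
    (A : PSL(2, F)) • affPoint t = affPoint t' ↔
      A.1 0 0 * t + A.1 0 1 = t' * (A.1 1 0 * t + A.1 1 1) := by
  rw [Matrix.ProjectiveSpecialLinearGroup.smul_proj_mk, affPoint, affPoint,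
    Projectivization.smul_mk, mk_eq_mk_iff_cross]
  simp [Matrix.SpecialLinearGroup.smul_def, Matrix.mulVec, dotProduct, Fin.sum_univ_two,
    mul_comm t']

theorem coe_eq_one_of_scalar {A : SL(2, F)} (h : A.1 1 0 = 0) (h' : A.1 0 1 = 0)
    (h2 : A.1 0 0 = A.1 1 1) : (A : PSL(2, F)) = 1 := by
  rw [QuotientGroup.eq_one_iff, Matrix.SpecialLinearGroup.mem_center_iff]
  have hdet := A.2
  rw [Matrix.det_fin_two, h, h'] at hdet
  refine ⟨A.1 0 0, ?_, ?_⟩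
  · rw [Fintype.card_fin]
    linear_combination hdet + A.1 0 0 * h2
  · ext i j
    fin_cases i <;> fin_cases j <;> simp [h, h', h2]

/-- The upper unitriangular matrices. -/
def shear (a : F) : SL(2, F) := ⟨!![1, a; 0, 1], by simp⟩

theorem mem_lineStab_infPoint_iff (A : SL(2, F)) :
    A ∈ lineStab (infPoint F).submodule ↔ ∃ a, A = shear a := by
  rw [infPoint, Projectivization.submodule_mk]
  constructor
  · intro hA
    have h1 := hA ![0, 1]
    have h0 := lineStab_fix_of_span _ (by simp) A hA
    obtain ⟨a, ha⟩ := Submodule.mem_span_singleton.1 h1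
    refine ⟨A.1 0 1, ?_⟩
    have e1 := congrFun h0 0
    have e2 := congrFun h0 1
    have e3 := congrFun ha 1
    simp [Matrix.SpecialLinearGroup.smul_def, Matrix.mulVec, dotProduct] at e1 e2 e3
    ext i j
    fin_cases i <;> fin_cases j <;> simp [shear, e1, e2]
    linear_combination -e3
  · rintro ⟨a, rfl⟩ w
    rw [Submodule.mem_span_singleton, Matrix.SpecialLinearGroup.smul_def]
    refine ⟨a * w 1, ?_⟩
    ext i
    fin_cases i <;> simp [shear, Matrix.vecHead, Matrix.vecTail]

theorem mem_iwasawaT_infPoint_iff (g : PSL(2, F)) :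
    g ∈ PSL.iwasawaT (infPoint F) ↔ ∃ a : F, g = (shear a : SL(2, F)) := by
  rw [PSL.iwasawaT, Subgroup.mem_map]
  constructor
  · rintro ⟨A, hA, rfl⟩
    obtain ⟨a, rfl⟩ := (mem_lineStab_infPoint_iff A).1 hA
    exact ⟨a, rfl⟩
  · rintro ⟨a, rfl⟩
    exact ⟨shear a, (mem_lineStab_infPoint_iff _).2 ⟨a, rfl⟩, rfl⟩

theorem shear_smul_affPoint (a t : F) :
    ((shear a : SL(2, F)) : PSL(2, F)) • affPoint t = affPoint (t + a) := by
  rw [coe_smul_affPoint_eq_iff]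
  simp [shear]

instance : MulAction.IsMultiplyPretransitive PSL(2, F) (ℙ F (Fin 2 → F)) 2 := by
  have h : MulAction.IsMultiplyPretransitive SL(2, F) (ℙ F (Fin 2 → F)) 2 := inferInstance
  rw [MulAction.is_two_pretransitive_iff] at h ⊢
  intro a b c d hab hcd
  obtain ⟨g, h1, h2⟩ := h hab hcd
  exact ⟨(g : PSL(2, F)), h1, h2⟩

theorem exists_smul_infPoint_affPoint {x y : ℙ F (Fin 2 → F)} (hxy : y ≠ x) :
    ∃ g : PSL(2, F), g • infPoint F = x ∧ g • affPoint 0 = y :=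
  (MulAction.is_two_pretransitive_iff.1 inferInstance) (affPoint_ne_infPoint (0 : F)).symm hxy.symm

theorem exists_smul_infPoint (x : ℙ F (Fin 2 → F)) : ∃ g : PSL(2, F), g • infPoint F = x := by
  by_cases hx : x = infPoint F
  · exact ⟨1, by simp [hx]⟩
  · obtain ⟨g, hg, -⟩ := exists_smul_infPoint_affPoint (Ne.symm hx)
    exact ⟨g, hg⟩

theorem conj_mem_iwasawaT (g : PSL(2, F)) (x : ℙ F (Fin 2 → F)) (u : PSL(2, F))
    (hu : u ∈ PSL.iwasawaT x) : g * u * g⁻¹ ∈ PSL.iwasawaT (g • x) := by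
  have h := (PSL2.Iwasawa (F := F)).is_conj g x
  change PSL.iwasawaT (g • x) = _ at h
  rw [h]
  exact Subgroup.smul_mem_pointwise_smul u (MulAut.conj g) _ hu

theorem existsUnique_iwasawaT_infPoint {y z : ℙ F (Fin 2 → F)} (hy : y ≠ infPoint F)
    (hz : z ≠ infPoint F) : ∃! u, u ∈ PSL.iwasawaT (infPoint F) ∧ u • y = z := by
  obtain ⟨t, rfl⟩ := exists_affPoint hy
  obtain ⟨t', rfl⟩ := exists_affPoint hz
  refine ⟨(shear (t' - t) : SL(2, F)), ⟨(mem_iwasawaT_infPoint_iff _).2 ⟨_, rfl⟩, ?_⟩, ?_⟩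
  · rw [shear_smul_affPoint, add_sub_cancel]
  · rintro u ⟨hu, hut⟩
    obtain ⟨a, rfl⟩ := (mem_iwasawaT_infPoint_iff _).1 hu
    rw [shear_smul_affPoint] at hut
    rw [← affPoint_injective hut, add_sub_cancel_left]

/-- An upper triangular matrix with distinct diagonal entries has a second fixed point; with equal
ones it is a scalar times a shear. -/
theorem mem_iwasawaT_infPoint_of_fixes_only {g : PSL(2, F)} (hg : g • infPoint F = infPoint F)
    (h : ∀ y, g • y = y → y = infPoint F) : g ∈ PSL.iwasawaT (infPoint F) := by
  obtain ⟨A, rfl⟩ := QuotientGroup.mk_surjective g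
  have hA := (coe_smul_infPoint_eq_iff A).1 hg
  have hdet := A.2
  rw [Matrix.det_fin_two, hA] at hdet
  have hne : A.1 0 0 ≠ 0 := by
    intro h0
    simp [h0] at hdet
  have heq : A.1 0 0 = A.1 1 1 := by
    by_contra hneq
    have hd : A.1 1 1 - A.1 0 0 ≠ 0 := sub_ne_zero.2 (Ne.symm hneq)
    -- The witness solves `A₀₀ t + A₀₁ = t A₁₁`.
    refine affPoint_ne_infPoint _ (h (affPoint (A.1 0 1 / (A.1 1 1 - A.1 0 0))) ?_)
    refine (coe_smul_affPoint_eq_iff A _ _).2 ?_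
    rw [hA]
    field_simp
    ring
  rw [mem_iwasawaT_infPoint_iff]
  refine ⟨A.1 0 1 / A.1 0 0, ?_⟩
  rw [← mul_inv_eq_one]
  have key : (A * (shear (A.1 0 1 / A.1 0 0))⁻¹ : SL(2, F)).1 = !![A.1 0 0, 0; 0, A.1 0 0] := by
    rw [Matrix.SpecialLinearGroup.coe_mul, Matrix.SpecialLinearGroup.coe_inv, shear,
      Matrix.adjugate_fin_two]
    ext i j
    fin_cases i <;> fin_cases j <;> simp [Matrix.mul_apply, Fin.sum_univ_two, hA, heq]
    rw [mul_div_cancel₀ _ (heq ▸ hne), neg_add_cancel]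
  refine coe_eq_one_of_scalar ?_ ?_ ?_ <;> rw [key] <;> simp

theorem eq_one_of_fixes_infPoint_zero {g : PSL(2, F)} (h1 : g • infPoint F = infPoint F)
    (h2 : g • affPoint (0 : F) = affPoint 0) {z : ℙ F (Fin 2 → F)} (hz : z ≠ infPoint F)
    (hz' : z ≠ affPoint 0) (h3 : g • z = z) : g = 1 := by
  obtain ⟨A, rfl⟩ := QuotientGroup.mk_surjective g
  obtain ⟨t, rfl⟩ := exists_affPoint hz
  have ht : t ≠ 0 := fun h => hz' (by rw [h])
  have e1 := (coe_smul_infPoint_eq_iff A).1 h1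
  have e2 := (coe_smul_affPoint_eq_iff A _ _).1 h2
  have e3 := (coe_smul_affPoint_eq_iff A _ _).1 h3
  have e2' : A.1 0 1 = 0 := by simpa using e2
  refine coe_eq_one_of_scalar e1 e2' (mul_right_cancel₀ ht ?_)
  rw [e1, e2'] at e3
  linear_combination e3

/-- Each axiom is checked at infinity, or at infinity and zero, and transported by conjugation using
2-transitivity. -/
theorem isRootFamily_iwasawaT :
    IsRootFamily (PSL.iwasawaT : ℙ F (Fin 2 → F) → Subgroup PSL(2, F)) where
  conj_mem := conj_mem_iwasawaT
  smul_eq x u hu := by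
    obtain ⟨g, rfl⟩ := exists_smul_infPoint x
    have h := conj_mem_iwasawaT g⁻¹ _ u hu
    rw [inv_smul_smul, mem_iwasawaT_infPoint_iff] at h
    obtain ⟨a, ha⟩ := h
    have h2 : (g⁻¹ * u * g⁻¹⁻¹) • infPoint F = infPoint F := by
      rw [ha, coe_smul_infPoint_eq_iff]
      simp [shear]
    simpa [mul_smul, inv_smul_eq_iff] using h2
  existsUnique x y z hy hz := by
    obtain ⟨g, rfl⟩ := exists_smul_infPoint x
    have hy' : g⁻¹ • y ≠ infPoint F := by rwa [Ne, inv_smul_eq_iff]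
    have hz' : g⁻¹ • z ≠ infPoint F := by rwa [Ne, inv_smul_eq_iff]
    obtain ⟨u, ⟨hu, huy⟩, huniq⟩ := existsUnique_iwasawaT_infPoint hy' hz'
    refine ⟨g * u * g⁻¹, ⟨conj_mem_iwasawaT g _ u hu, ?_⟩, ?_⟩
    · rw [mul_smul, mul_smul, huy, smul_inv_smul]
    · rintro v ⟨hv, hvy⟩
      rw [← huniq (g⁻¹ * v * g) ⟨?_, ?_⟩]
      · group
      · simpa using conj_mem_iwasawaT g⁻¹ _ v hv
      · rw [mul_smul, mul_smul, smul_inv_smul, hvy]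
  eq_one g x y z hxy hxz hyz hx hy hz := by
    obtain ⟨h, rfl, rfl⟩ := exists_smul_infPoint_affPoint hxy.symm
    have key : h⁻¹ * g * h = 1 := by
      refine eq_one_of_fixes_infPoint_zero (z := h⁻¹ • z) ?_ ?_ ?_ ?_ ?_
      · rw [mul_smul, mul_smul, hx, inv_smul_smul]
      · rw [mul_smul, mul_smul, hy, inv_smul_smul]
      · rw [Ne, inv_smul_eq_iff]; exact hxz.symm
      · rw [Ne, inv_smul_eq_iff]; exact hyz.symm
      · rw [mul_smul, mul_smul, smul_inv_smul, hz]
    have := congrArg (fun k => h * k * h⁻¹) key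
    simpa [mul_assoc] using this
  mem_of_fixes_only g x hx honly := by
    obtain ⟨h, rfl⟩ := exists_smul_infPoint x
    have key : h⁻¹ * g * h ∈ PSL.iwasawaT (infPoint F) := by
      refine mem_iwasawaT_infPoint_of_fixes_only ?_ fun y hy => ?_
      · rw [mul_smul, mul_smul, hx, inv_smul_smul]
      · rw [mul_smul, mul_smul, inv_smul_eq_iff] at hy
        exact smul_left_cancel h (honly _ hy)
    simpa [mul_assoc] using conj_mem_iwasawaT h _ _ key
  iSup_eq_top := PSL.iSup_iwasawaT_eq_top

/-- The diagonal matrices of determinant one. -/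
def torus (a : Fˣ) : SL(2, F) := ⟨!![(a : F), 0; 0, ((a⁻¹ : Fˣ) : F)], by simp⟩

/-- The diagonal matrices fix both points, and `torus a` sends `affPoint 1` to `affPoint (a * a)`.
Hence at most the two units `a` and `-a` have the same image in `PSL(2, F)`. -/
theorem card_le_two_mul_card_pair [Fintype F] [DecidableEq F] [Fintype PSL(2, F)]
    [DecidableEq (ℙ F (Fin 2 → F))] :
    Fintype.card F ≤ 2 * #{g : PSL(2, F) | g • infPoint F = infPoint F ∧
      g • affPoint (0 : F) = affPoint 0} + 1 := by
  classical
  have h : #(univ : Finset Fˣ) ≤ 2 * #{g : PSL(2, F) | g • infPoint F = infPoint F ∧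
      g • affPoint (0 : F) = affPoint 0} := by
    refine card_le_mul_card_image_of_maps_to (f := fun a : Fˣ => ((torus a : SL(2, F)) : PSL(2, F)))
      (fun a _ => ?_) 2 fun g _ => ?_
    · rw [mem_filter, coe_smul_infPoint_eq_iff, coe_smul_affPoint_eq_iff]
      simp [torus]
    · by_cases hg : ∃ a : Fˣ, ((torus a : SL(2, F)) : PSL(2, F)) = g
      · obtain ⟨a, rfl⟩ := hg
        refine (card_le_card (t := {a, -a}) fun b hb => ?_).trans card_le_two
        have hb' := (mem_filter.1 hb).2
        have e1 : ((torus a : SL(2, F)) : PSL(2, F)) • affPoint 1 = affPoint ((a : F) * a) := by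
          rw [coe_smul_affPoint_eq_iff]
          simp [torus]
        have e2 : ((torus b : SL(2, F)) : PSL(2, F)) • affPoint 1 = affPoint ((b : F) * b) := by
          rw [coe_smul_affPoint_eq_iff]
          simp [torus]
        rw [hb', e1] at e2
        have := affPoint_injective e2
        rw [mem_insert, mem_singleton]
        rcases mul_self_eq_mul_self_iff.1 this.symm with h | h
        · exact Or.inl (Units.ext h)
        · exact Or.inr (Units.ext (by simpa using h))
      · rw [filter_false_of_mem fun a _ ha => hg ⟨a, ha⟩]
        simp
  rw [card_univ, Fintype.card_units] at h
  omega

end PSL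

end EKR

theorem mainTheorem6 {F : Type*} [Field F] [Finite F] :
    EKR.HasEKRProperty PSL(2, F) (ℙ F (Fin 2 → F)) ∧
    Disjoint (EKR.trivialModule PSL(2, F))
      (EKR.standardModule PSL(2, F) (ℙ F (Fin 2 → F))) ∧
    ∀ S : Finset PSL(2, F),
      EKR.IsMaximumIntersecting PSL(2, F) (ℙ F (Fin 2 → F)) S →
      EKR.characteristicVector PSL(2, F) S ∈
        EKR.trivialModule PSL(2, F) ⊔
          EKR.standardModule PSL(2, F) (ℙ F (Fin 2 → F)) := by
  classical
  have : Fintype F := Fintype.ofFinite F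
  have : Fintype PSL(2, F) := Fintype.ofFinite _
  have : Fintype (ℙ F (Fin 2 → F)) := Fintype.ofFinite _
  have hU := EKR.isRootFamily_iwasawaT (F := F)
  have hq : 2 ≤ Fintype.card F := Fintype.one_lt_card
  have hΩ : Fintype.card (ℙ F (Fin 2 → F)) = Fintype.card F + 1 := by
    rw [← Nat.card_eq_fintype_card, ← Nat.card_eq_fintype_card]
    exact Projectivization.card_of_finrank_two F _ (by simp)
  have hne := (EKR.affPoint_ne_infPoint (0 : F)).symm
  have hs : EKR.HasPairCount PSL(2, F) (ℙ F (Fin 2 → F)) _ :=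
    fun a c b d h h' => EKR.card_pair_eq h h' hne hne
  have hs0 : 1 ≤ Finset.card {g : PSL(2, F) | g • EKR.infPoint F = EKR.infPoint F ∧
      g • EKR.affPoint (0 : F) = EKR.affPoint 0} :=
    Finset.card_pos.2 ⟨1, by simp⟩
  have hs2 := EKR.card_le_two_mul_card_pair (F := F)
  exact ⟨EKR.hasEKRProperty_of_isRootFamily hU hq hs0 hΩ hs hs2,
    EKR.disjoint_trivialModule_standardModule (hs.sum_fixCount_eq_card hq hΩ),
    fun S hS => EKR.characteristicVector_mem_of_isRootFamily hU hq hs0 hΩ hs hs2 hS⟩
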